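/- Let $K$ be a field and let $q\in K$ satisfy $q^k\neq 1$ for all integers $k\ge 1$ (for example $K=\mathbb{Q}(q)$ with $q$ an indeterminate, or $q\in\mathbb{C}$ with $|q|<1$). For $n\ge 0$ put $(a;q)_n:=\prod_{i=0}^{n-1}(1-aq^i)$, and put $1/(q;q)_n:=0$ for integers $n<0$. For integers $A,k$ let ${A\brack k}_q:=\frac{(q;q)_A}{(q;q)_k(q;q)_{A-k}}$ if $0\le k\le A$, and ${A\brack k}_q:=0$ otherwise. Let $\left(\frac{\cdot}{3}\right)$ be the Jacobi symbol modulo $3$. Let $L\ge 0$ and $1\le s\le f$ be integers, and for non-negative integers $n_1,\dots,n_f$ put $N_i:=n_i+n_{i+1}+\dots+n_f$ for $1\le i\le f$. Then $$\sum_{m,n,n_1,\dots,n_f\ge 0}\frac{q^{2m^2+6mn+6n^2+N_1^2+\dots+N_f^2+N_{f-s+1}+\dots+N_f}\,(q;q)_{2L}\,(q;q)_{n_f}}{(q;q)_m\,(q^3;q^3)_n\,(q;q)_{L-N_1}\,(q;q)_{n_f-3n-2m}\,(q;q)_{n_1}(q;q)_{n_2}\cdots(q;q)_{n_{f-1}}\,(q;q)_{2n_f}}=\sum_{j=-L}^{L}\left(\frac{j+1}{3}\right)q^{(f+1)j^2-sj}{2L\brack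 L-j}_q ,$$ where only finitely many terms of the sum on the left are nonzero. -/

import Mathlib

namespace Capparelli

/-- The `q`-Pochhammer symbol `(a;q)_n = (1 - a)(1 - aq)⋯(1 - aq^(n-1))`. -/
def qPochhammer {K : Type*} [Field K] (a q : K) (n : ℕ) : K :=
  ∏ i ∈ Finset.range n, (1 - a * q ^ i)

/-- The reciprocal `1 / (q;q)_k` for an integer index `k`, which is `0` for negative `k`. -/
def qPochhammerRecip {K : Type*} [Field K] (q : K) (k : ℤ) : K :=
  if 0 ≤ k then 1 / qPochhammer q q k.toNat else 0

/-- The `q`-binomial coefficient `(q;q)_A / ((q;q)_k (q;q)_(A-k))` for `0 ≤ k ≤ A`,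
and `0` otherwise. -/
def qBinomial {K : Type*} [Field K] (q : K) (A k : ℤ) : K :=
  if 0 ≤ k ∧ 0 ≤ A - k then
    qPochhammer q q A.toNat / (qPochhammer q q k.toNat * qPochhammer q q (A - k).toNat)
  else 0

/-- The entry `n_i`, `1 ≤ i ≤ f`, of a tuple `(n_1, …, n_f)` (with one-based index `i`). -/
def entry {f : ℕ} (n : Fin f → ℕ) (i : ℕ) : ℕ :=
  if h : 1 ≤ i ∧ i ≤ f then n ⟨i - 1, by omega⟩ else 0

/-- The tail sum `N_i = n_i + n_(i+1) + ⋯ + n_f` (so that `N_(f+1) = 0`). -/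
def tailSum {f : ℕ} (n : Fin f → ℕ) (i : ℕ) : ℕ :=
  ∑ k ∈ Finset.Icc i f, entry n k

/-- The summand of the multisum over `m, n, n_1, …, n_f`; here `v = (n_1, …, n_f)`. -/
def summand {K : Type*} [Field K] (q : K) (L f s m n : ℕ) (v : Fin f → ℕ) : K :=
  q ^ (2 * m ^ 2 + 6 * m * n + 6 * n ^ 2 + ∑ i ∈ Finset.Icc 1 f, tailSum v i ^ 2
        + ∑ i ∈ Finset.Icc (f - s + 1) f, tailSum v i)
    * qPochhammer q q (2 * L) * qPochhammer q q (entry v f)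
    / (qPochhammer q q m * qPochhammer (q ^ 3) (q ^ 3) n
        * (∏ i ∈ Finset.Icc 1 (f - 1), qPochhammer q q (entry v i))
        * qPochhammer q q (2 * entry v f))
    * qPochhammerRecip q ((L : ℤ) - (tailSum v 1 : ℤ))
    * qPochhammerRecip q ((entry v f : ℤ) - 3 * (n : ℤ) - 2 * (m : ℤ))

end Capparelli

/-! The proof is a Bailey chain. Put $\chi(j)=\left(\frac{j+1}{3}\right)$ and $B_L(c)=\sum_j
c_j/((q;q)_{L-j}(q;q)_{L+j})$. Dividing the right side by $(q;q)_{2L}$ gives $B_L$ of the sequence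
$q^{(f+1)j^2-sj}\chi(j)$.

The seed (`capSum_eq_baileySum`) says that the inner double sum over $m,n$, multiplied by
$(q;q)_r/(q;q)_{2r}$ with $r=n_f$, equals $B_r(q^{j^2}\chi)$. After normalization both sides obey
one second-order recurrence in $r$. For $B_r$ it comes from $\chi(j-1)+\chi(j)+\chi(j+1)=0$; for the
double sum, from a $q$-difference equation of its generating function.

Each sum over an $n_i$ is then one step of the chain. With weight $q^{N_i^2}$, the Bailey lemma, a
consequence of $q$-Chu–Vandermonde, multiplies $c_j$ by $q^{j^2}$. With weight $q^{N_i^2+N_i}$,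
`bailey_lattice_step` multiplies it by $q^{j^2-j}$, provided $q^{-j}c_j$ is antisymmetric under
$j\mapsto 1-j$. The $s$ innermost steps are of the second kind and the other $f-s$ of the first, so
$q^{j^2}$ becomes $q^{(f+1)j^2-sj}$. -/

namespace Capparelli

/-! ### Pochhammer symbols, q-Chu–Vandermonde and the Bailey kernel -/

section Basics

variable {K : Type*} [Field K] {q : K}

theorem qPochhammer_succ (a q : K) (n : ℕ) :
    qPochhammer a q (n + 1) = qPochhammer a q n * (1 - a * q ^ n) :=
  Finset.prod_range_succ _ _

theorem qPochhammer_zero (a q : K) : qPochhammer a q 0 = 1 := rfl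

theorem qPochhammer_self_succ (q : K) (n : ℕ) :
    qPochhammer q q (n + 1) = qPochhammer q q n * (1 - q ^ (n + 1)) := by
  rw [qPochhammer_succ, pow_succ']

theorem one_sub_pow_ne_zero (hq : ∀ k : ℕ, 1 ≤ k → q ^ k ≠ 1) {n : ℕ} (hn : 1 ≤ n) :
    1 - q ^ n ≠ 0 :=
  sub_ne_zero.2 (hq n hn).symm

theorem qPochhammer_self_ne_zero (hq : ∀ k : ℕ, 1 ≤ k → q ^ k ≠ 1) (n : ℕ) :
    qPochhammer q q n ≠ 0 := by
  refine Finset.prod_ne_zero_iff.2 fun i _ => ?_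
  rw [← pow_succ']
  exact one_sub_pow_ne_zero hq (by omega)

theorem qPochhammer_cube_ne_zero (hq : ∀ k : ℕ, 1 ≤ k → q ^ k ≠ 1) (n : ℕ) :
    qPochhammer (q ^ 3) (q ^ 3) n ≠ 0 := by
  refine qPochhammer_self_ne_zero (fun k hk => ?_) n
  rw [← pow_mul]
  exact hq _ (by omega)

theorem qPochhammerRecip_of_neg (q : K) {k : ℤ} (hk : k < 0) : qPochhammerRecip q k = 0 :=
  if_neg (by omega)

theorem qPochhammerRecip_natCast (q : K) (n : ℕ) :
    qPochhammerRecip q n = 1 / qPochhammer q q n := by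
  simp [qPochhammerRecip]

theorem qPochhammerRecip_zero (q : K) : qPochhammerRecip q 0 = 1 := by
  simp [qPochhammerRecip, qPochhammer]

theorem qPochhammerRecip_sub_one (hq : ∀ k : ℕ, 1 ≤ k → q ^ k ≠ 1) (n : ℤ) :
    qPochhammerRecip q (n - 1) = (1 - q ^ n) * qPochhammerRecip q n := by
  rcases lt_trichotomy n 0 with h | rfl | h
  · rw [qPochhammerRecip_of_neg q h, qPochhammerRecip_of_neg q (by omega), mul_zero]
  · simp [qPochhammerRecip]
  · obtain ⟨m, rfl⟩ : ∃ m : ℕ, n = (m : ℤ) + 1 := ⟨(n - 1).toNat, by omega⟩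
    have h1 := qPochhammer_self_ne_zero hq m
    have h2 := one_sub_pow_ne_zero hq (n := m + 1) (by omega)
    rw [add_sub_cancel_right]
    have : ((m : ℤ) + 1) = ((m + 1 : ℕ) : ℤ) := by push_cast; rfl
    rw [this, qPochhammerRecip_natCast, qPochhammerRecip_natCast, zpow_natCast,
      qPochhammer_self_succ]
    field_simp

theorem finite_support_of_Icc {φ : ℤ → K} (a b : ℤ) (h : ∀ k, k < a ∨ b < k → φ k = 0) :
    (Function.support φ).Finite := by
  refine (Set.finite_Icc a b).subset fun k hk => ?_
  by_contra hk'
  rw [Set.mem_Icc, not_and_or, not_le, not_le] at hk'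
  exact hk (h k hk')

/-- A limiting form of the `q`-Chu–Vandermonde summation. -/
theorem qVandermonde (hq : ∀ k : ℕ, 1 ≤ k → q ^ k ≠ 1) (hq0 : q ≠ 0) (n : ℕ) (a : ℤ) :
    ∑ᶠ k : ℤ, q ^ (k ^ 2 + a * k) * qPochhammerRecip q (n - k) * qPochhammerRecip q k
      * qPochhammerRecip q (k + a) = qPochhammerRecip q n * qPochhammerRecip q (n + a) := by
  induction n generalizing a with
  | zero =>
    rw [finsum_eq_single _ (0 : ℤ)]
    · simp [qPochhammerRecip_zero]
    · intro k hk
      rcases lt_or_gt_of_ne hk with h | h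
      · simp [qPochhammerRecip_of_neg q h]
      · rw [qPochhammerRecip_of_neg q (k := (0 : ℕ) - k) (by push_cast; omega)]
        simp
  | succ n ih =>
    have hne : (1 - q ^ ((n : ℤ) + 1)) ≠ 0 := by
      have := one_sub_pow_ne_zero hq (n := n + 1) (by omega)
      exact_mod_cast this
    refine mul_left_cancel₀ hne ?_
    have shift := finsum_comp_equiv (Equiv.subRight (1 : ℤ))
      (f := fun k : ℤ => q ^ (k ^ 2 + (a + 1) * k) * qPochhammerRecip q (n - k)
        * qPochhammerRecip q k * qPochhammerRecip q (k + (a + 1)))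
    rw [ih] at shift
    have hfin : ∀ (m : ℤ) (b : ℤ), (Function.support fun k : ℤ =>
        q ^ (k ^ 2 + b * k) * qPochhammerRecip q (m - k)
        * qPochhammerRecip q k * qPochhammerRecip q (k + b)).Finite := fun m b =>
      finite_support_of_Icc 0 m fun k hk => by
        rcases hk with h | h
        · simp [qPochhammerRecip_of_neg q h]
        · rw [qPochhammerRecip_of_neg q (k := m - k) (by omega)]; simp
    have h1 := ih a
    rw [mul_finsum]
    -- Split $1-q^{n+1}=(1-q^{n+1-k})+q^{n+1-k}(1-q^k)$. The first part lowers $n+1$ to $n$; the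
    -- second lowers $k$, giving the case $(n,a+1)$ shifted by one.
    calc _ = ∑ᶠ k : ℤ, (q ^ (k ^ 2 + a * k) * qPochhammerRecip q (n - k)
              * qPochhammerRecip q k * qPochhammerRecip q (k + a)
            + q ^ ((n : ℤ) + 1 + a) * (q ^ ((k - 1) ^ 2 + (a + 1) * (k - 1))
              * qPochhammerRecip q (n - (k - 1))
              * qPochhammerRecip q (k - 1) * qPochhammerRecip q ((k - 1) + (a + 1)))) := by
          refine finsum_congr fun k => ?_
          have e1 : (n : ℤ) - k = ((n + 1 : ℕ) : ℤ) - k - 1 := by push_cast; ring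
          have e2 : (n : ℤ) - (k - 1) = ((n + 1 : ℕ) : ℤ) - k := by push_cast; ring
          have e3 : k - 1 + (a + 1) = k + a := by ring
          rw [e1, e2, e3, qPochhammerRecip_sub_one hq, qPochhammerRecip_sub_one hq]
          have e4 : q ^ ((n : ℤ) + 1 + a) * q ^ ((k - 1) ^ 2 + (a + 1) * (k - 1))
              = q ^ (k ^ 2 + a * k) * q ^ (((n + 1 : ℕ) : ℤ) - k) := by
            rw [← zpow_add₀ hq0, ← zpow_add₀ hq0]; congr 1; push_cast; ring
          have e5 : q ^ ((n : ℤ) + 1) = q ^ (((n + 1 : ℕ) : ℤ) - k) * q ^ k := by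
            rw [← zpow_add₀ hq0]; congr 1; push_cast; ring
          rw [e5]
          linear_combination (-(1 - q ^ k)) * qPochhammerRecip q (((n + 1 : ℕ) : ℤ) - k)
            * qPochhammerRecip q k * qPochhammerRecip q (k + a) * e4
      _ = _ := by
          have hf2 := (hfin n (a + 1)).preimage (Equiv.subRight (1 : ℤ)).injective.injOn
          have hf2' : (Function.support fun k : ℤ => q ^ ((n : ℤ) + 1 + a) *
              (q ^ ((k - 1) ^ 2 + (a + 1) * (k - 1))
              * qPochhammerRecip q (n - (k - 1))
              * qPochhammerRecip q (k - 1) * qPochhammerRecip q ((k - 1) + (a + 1)))).Finite :=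
            hf2.subset fun k hk => by
              have := right_ne_zero_of_mul (Function.mem_support.1 hk)
              exact this
          rw [finsum_add_distrib (hfin n a) hf2', h1, ← mul_finsum]
          simp only [Equiv.subRight_apply] at shift
          rw [shift]
          have e1 : (n : ℤ) = (n + 1 : ℤ) - 1 := by ring
          have e2 : (n : ℤ) + a = (n + 1 + a : ℤ) - 1 := by ring
          have e3 : (n : ℤ) + (a + 1) = (n + 1 + a : ℤ) := by ring
          have h3 := qPochhammerRecip_sub_one hq ((n : ℤ) + 1)
          rw [← e1] at h3
          rw [e2, e3, h3, qPochhammerRecip_sub_one hq]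
          push_cast
          ring

/-- The Bailey lemma kernel at parameter `q ^ b`. -/
theorem bailey_kernel (hq : ∀ k : ℕ, 1 ≤ k → q ^ k ≠ 1) (hq0 : q ≠ 0) (L : ℕ) (j : ℤ) (b : ℕ)
    (hb : b ≤ 1) :
    ∑ r ∈ Finset.range (L + 1), q ^ (r ^ 2 + b * r) * qPochhammerRecip q ((L : ℤ) - r)
        * (qPochhammerRecip q (r - j) * qPochhammerRecip q (r + b + j))
      = q ^ (j ^ 2 + b * j) * (qPochhammerRecip q (L - j) * qPochhammerRecip q (L + b + j)) := by
  rcases lt_or_ge (L : ℤ) j with h | h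
  · rw [qPochhammerRecip_of_neg q (k := (L : ℤ) - j) (by omega)]
    rw [Finset.sum_eq_zero]
    · simp
    · intro r hr
      rw [Finset.mem_range] at hr
      rw [qPochhammerRecip_of_neg q (k := (r : ℤ) - j) (by omega)]
      simp
  -- This is `qVandermonde` with $n=L-j$, $k=r-j$ and $a=2j+b$.
  obtain ⟨n, hn⟩ : ∃ n : ℕ, (n : ℤ) = L - j := ⟨(L - j).toNat, by omega⟩
  have h1 := qVandermonde hq hq0 n (2 * j + b)
  have h2 := finsum_comp_equiv (Equiv.subRight j) (f := fun k : ℤ =>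
    q ^ (k ^ 2 + (2 * j + b) * k) * qPochhammerRecip q (n - k) * qPochhammerRecip q k
      * qPochhammerRecip q (k + (2 * j + b)))
  rw [h1] at h2
  have e1 : (n : ℤ) + (2 * j + b) = L + b + j := by rw [hn]; ring
  rw [e1, hn] at h2
  rw [← h2]
  have key : (Function.support fun k : ℤ => (fun k : ℤ =>
    q ^ (k ^ 2 + (2 * j + b) * k) * qPochhammerRecip q (n - k) * qPochhammerRecip q k
      * qPochhammerRecip q (k + (2 * j + b))) (Equiv.subRight j k)) ⊆
      ((Finset.range (L + 1)).map Nat.castEmbedding : Finset ℤ) := by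
    intro k hk
    simp only [Equiv.subRight_apply, Function.mem_support] at hk
    have c1 : 0 ≤ k - j := by
      by_contra hc
      exact hk (by rw [qPochhammerRecip_of_neg q (k := k - j) (by omega)]; simp)
    have c2 : 0 ≤ n - (k - j) := by
      by_contra hc
      exact hk (by rw [qPochhammerRecip_of_neg q (k := n - (k - j)) (by omega)]; simp)
    have c3 : 0 ≤ k - j + (2 * j + b) := by
      by_contra hc
      exact hk (by
        rw [qPochhammerRecip_of_neg q (k := k - j + (2 * j + b)) (by omega)]; simp)
    simp only [Finset.coe_map, Set.mem_image, Finset.mem_coe, Finset.mem_range,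
      Nat.castEmbedding_apply]
    -- Adding `c1` and `c3` gives $2k+b\ge 0$, so $b\le 1$ forces $k\ge 0$.
    exact ⟨k.toNat, by omega, by omega⟩
  rw [← hn, finsum_eq_sum_of_support_subset _ key, Finset.sum_map, Finset.mul_sum]
  refine Finset.sum_congr rfl fun r _ => ?_
  simp only [Equiv.subRight_apply, Nat.castEmbedding_apply]
  have e2 : (n : ℤ) - ((r : ℤ) - j) = L - r := by rw [hn]; ring
  have e3 : (r : ℤ) - j + (2 * j + b) = r + b + j := by ring
  have e4 : q ^ (r ^ 2 + b * r) = q ^ (j ^ 2 + b * j) *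
      q ^ (((r : ℤ) - j) ^ 2 + (2 * j + b) * ((r : ℤ) - j)) := by
    rw [← zpow_add₀ hq0, ← zpow_natCast]; congr 1; push_cast; ring
  rw [e2, e3, e4]
  ring

end Basics

/-! ### Bailey lemma and the change of parameter -/

section BaileySum

variable {K : Type*} [Field K] {q : K}

/-- The Bailey transform `∑ j, c j / ((q)_(L-j) (q)_(L+b+j))` of a bilateral sequence `c`. -/
noncomputable def baileySum (q : K) (b : ℕ) (c : ℤ → K) (L : ℕ) : K :=
  ∑ᶠ j : ℤ, c j * (qPochhammerRecip q (L - j) * qPochhammerRecip q (L + b + j))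

theorem qPochhammerRecip_mul_eq_zero (q : K) {a b : ℤ} (h : a < 0 ∨ b < 0) :
    qPochhammerRecip q a * qPochhammerRecip q b = 0 := by
  rcases h with h | h <;> simp [qPochhammerRecip_of_neg q h]

theorem finite_support_baileySum (q : K) (b : ℕ) (c : ℤ → K) (L : ℕ) :
    (Function.support fun j : ℤ =>
      c j * (qPochhammerRecip q (L - j) * qPochhammerRecip q (L + b + j))).Finite :=
  finite_support_of_Icc (-(L + b : ℤ)) L fun k hk => by
    rw [qPochhammerRecip_mul_eq_zero q (by omega), mul_zero]

theorem bailey_lemma (hq : ∀ k : ℕ, 1 ≤ k → q ^ k ≠ 1) (hq0 : q ≠ 0) (L : ℕ) (b : ℕ)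
    (hb : b ≤ 1) (c : ℤ → K) :
    ∑ r ∈ Finset.range (L + 1), q ^ (r ^ 2 + b * r) * qPochhammerRecip q ((L : ℤ) - r)
        * baileySum q b c r
      = baileySum q b (fun j => q ^ (j ^ 2 + b * j) * c j) L := by
  simp only [baileySum, mul_finsum]
  rw [← finsum_sum_comm]
  · refine finsum_congr fun j => ?_
    rw [mul_right_comm, ← bailey_kernel hq hq0 L j b hb, Finset.sum_mul]
    exact Finset.sum_congr rfl fun r _ => by ring
  · intro r _
    exact (finite_support_baileySum q b c r).subset fun j hj => right_ne_zero_of_mul hj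

/-- The involution $j\mapsto 1-j$ swaps the two reciprocals and has no fixed integer, so terms
cancel in pairs in any characteristic. -/
theorem finsum_antisymm_eq_zero (q : K) {c : ℤ → K} (hc : ∀ j, c (1 - j) = -c j) (L : ℕ) :
    ∑ᶠ j : ℤ, c j * (qPochhammerRecip q (L + 1 - j) * qPochhammerRecip q (L + j)) = 0 := by
  rw [finsum_eq_sum_of_support_subset (s := Finset.Icc (-L : ℤ) (L + 1))]
  · refine Finset.sum_involution (fun j _ => 1 - j) (fun j _ => ?_) (fun j _ _ => by omega)
      (fun j hj => by rw [Finset.mem_Icc] at hj ⊢; omega) (fun j _ => by ring)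
    rw [hc, show (L : ℤ) + 1 - (1 - j) = L + j by ring, show (L : ℤ) + (1 - j) = L + 1 - j by ring]
    ring
  · intro j hj
    by_contra h
    rw [Finset.coe_Icc, Set.mem_Icc] at h
    exact hj (by beta_reduce; rw [qPochhammerRecip_mul_eq_zero q (by omega), mul_zero])

/-- Passage from parameter `1` to parameter `q` for antisymmetric sequences. -/
theorem baileySum_zero_eq_one (hq : ∀ k : ℕ, 1 ≤ k → q ^ k ≠ 1) (hq0 : q ≠ 0) {c : ℤ → K}
    (hc : ∀ j, c (1 - j) = -c j) (L : ℕ) :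
    baileySum q 0 (fun j => c j * q ^ j) L
      = baileySum q 1 (fun j => c (j + 1) * q ^ (j + 1)) L := by
  have h1 : baileySum q 1 (fun j => c (j + 1) * q ^ (j + 1)) L = ∑ᶠ j : ℤ,
      c j * q ^ j * (qPochhammerRecip q (L + 1 - j) * qPochhammerRecip q (L + j)) := by
    rw [← finsum_comp_equiv (Equiv.addRight (1 : ℤ)), baileySum]
    refine finsum_congr fun j => ?_
    simp only [Equiv.coe_addRight]
    rw [show (L : ℤ) + 1 - (j + 1) = L - j by ring,
      show (L : ℤ) + (j + 1) = L + (1 : ℕ) + j by push_cast; ring]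
  have hfin : ∀ d : ℤ → K, (Function.support fun j : ℤ =>
      d j * (qPochhammerRecip q (L + 1 - j) * qPochhammerRecip q (L + j))).Finite := fun d =>
    finite_support_of_Icc (-(L : ℤ)) (L + 1) fun k hk => by
      rw [qPochhammerRecip_mul_eq_zero q (by omega), mul_zero]
  -- Since $1/(q;q)_{L-j}=(1-q^{L+1-j})/(q;q)_{L+1-j}$, the two sides differ by $q^{L+1}$ times this
  -- vanishing sum.
  have h2 := finsum_antisymm_eq_zero q hc L
  rw [h1, ← sub_zero (∑ᶠ _, _), ← mul_zero (q ^ (L + 1)), ← h2, mul_finsum,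
    ← finsum_sub_distrib (hfin _) ((hfin c).subset fun j hj => right_ne_zero_of_mul hj), baileySum]
  refine finsum_congr fun j => ?_
  have e1 : (L : ℤ) - j = L + 1 - j - 1 := by ring
  have e2 : q ^ (L + 1) = q ^ j * q ^ ((L : ℤ) + 1 - j) := by
    rw [← zpow_add₀ hq0, ← zpow_natCast]; congr 1; push_cast; ring
  rw [e1, qPochhammerRecip_sub_one hq, e2, Nat.cast_zero, add_zero]
  ring

/-- Pass to parameter $q$, apply the Bailey lemma with $b=1$, and return. The new factor $q^{j^2-j}$
is invariant under $j\mapsto 1-j$, so antisymmetry survives and the step can be iterated. -/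
theorem bailey_lattice_step (hq : ∀ k : ℕ, 1 ≤ k → q ^ k ≠ 1) (hq0 : q ≠ 0) {c : ℤ → K}
    (hc : ∀ j, c (1 - j) = -c j) (L : ℕ) :
    ∑ r ∈ Finset.range (L + 1), q ^ (r ^ 2 + r) * qPochhammerRecip q ((L : ℤ) - r)
        * baileySum q 0 (fun j => c j * q ^ j) r
      = baileySum q 0 (fun j => q ^ (j ^ 2 - j) * c j * q ^ j) L := by
  rw [baileySum_zero_eq_one hq hq0 (c := fun j => q ^ (j ^ 2 - j) * c j)]
  · have h := bailey_lemma hq hq0 L 1 le_rfl (fun j => c (j + 1) * q ^ (j + 1))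
    simp only [one_mul, Nat.cast_one] at h
    simp only [baileySum_zero_eq_one hq hq0 hc, h]
    congr 1
    funext j
    rw [show (j + 1) ^ 2 - (j + 1) = j ^ 2 + j by ring, mul_assoc]
  · intro j
    rw [hc, show (1 - j) ^ 2 - (1 - j) = j ^ 2 - j by ring, mul_neg]

end BaileySum

/-! ### Recurrence in L for the bilateral sum -/

section Recurrence

variable {K : Type*} [Field K] {q : K}

/-- The normalized summand `q^(j^2) / ((q)_(L-j) (q)_(L+j))`. -/
noncomputable def gaussTerm (q : K) (L : ℕ) (j : ℤ) : K :=
  q ^ (j ^ 2) * (qPochhammerRecip q (L - j) * qPochhammerRecip q (L + j))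

theorem gaussTerm_recurrence (hq : ∀ k : ℕ, 1 ≤ k → q ^ k ≠ 1) (hq0 : q ≠ 0) (L : ℕ) (j : ℤ) :
    (1 - q ^ (2 * L + 3)) * (1 - q ^ (2 * L + 4)) * gaussTerm q (L + 2) j
      - (1 + q) * gaussTerm q (L + 1) j + q * gaussTerm q L j
      = q ^ (2 * L + 3) * (gaussTerm q (L + 1) (j - 1) + gaussTerm q (L + 1) (j + 1)) := by
  simp only [gaussTerm]
  push_cast
  have a1 : qPochhammerRecip q ((L : ℤ) + 1 - j)
      = (1 - q ^ ((L : ℤ) + 2 - j)) * qPochhammerRecip q ((L : ℤ) + 2 - j) := by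
    rw [← qPochhammerRecip_sub_one hq]; congr 1; ring
  have a2 : qPochhammerRecip q ((L : ℤ) - j)
      = (1 - q ^ ((L : ℤ) + 1 - j)) * qPochhammerRecip q ((L : ℤ) + 1 - j) := by
    rw [← qPochhammerRecip_sub_one hq]; congr 1; ring
  have b1 : qPochhammerRecip q ((L : ℤ) + 1 + j)
      = (1 - q ^ ((L : ℤ) + 2 + j)) * qPochhammerRecip q ((L : ℤ) + 2 + j) := by
    rw [← qPochhammerRecip_sub_one hq]; congr 1; ring
  have b2 : qPochhammerRecip q ((L : ℤ) + j)
      = (1 - q ^ ((L : ℤ) + 1 + j)) * qPochhammerRecip q ((L : ℤ) + 1 + j) := by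
    rw [← qPochhammerRecip_sub_one hq]; congr 1; ring
  rw [show (L : ℤ) + 1 - (j - 1) = L + 2 - j by ring, show (L : ℤ) + 1 + (j - 1) = L + j by ring,
    show (L : ℤ) + 1 - (j + 1) = L - j by ring, show (L : ℤ) + 1 + (j + 1) = L + 2 + j by ring,
    a2, b2, a1, b1, show (j - 1) ^ 2 = j ^ 2 + (-j - j + 1) by ring,
    show (j + 1) ^ 2 = j ^ 2 + (j + j + 1) by ring]
  simp only [zpow_add₀ hq0, zpow_sub₀ hq0, zpow_neg, zpow_natCast, zpow_ofNat]
  -- With every reciprocal reduced to indices $L+2\pm j$, what remains is a rational identity in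
  -- $x=q^L$, $y=q^j$ and $q$.
  have hy : q ^ j ≠ 0 := zpow_ne_zero _ hq0
  generalize q ^ j = y at *
  generalize q ^ (j ^ 2) = z
  rw [pow_add, pow_add, pow_mul']
  generalize q ^ L = x
  field_simp
  ring

/-- Sum `gaussTerm_recurrence` against $c_j$. Reindexing moves the shifts $j\pm1$ onto $c$, and
$c_{j-1}+c_{j+1}=-c_j$ leaves a recurrence in $L$ alone. -/
theorem baileySum_recurrence (hq : ∀ k : ℕ, 1 ≤ k → q ^ k ≠ 1) (hq0 : q ≠ 0) {c : ℤ → K}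
    (hc : ∀ j, c (j - 1) + c j + c (j + 1) = 0) (L : ℕ) :
    (1 - q ^ (2 * L + 3)) * (1 - q ^ (2 * L + 4))
        * baileySum q 0 (fun j => q ^ (j ^ 2) * c j) (L + 2)
      = (1 + q - q ^ (2 * L + 3)) * baileySum q 0 (fun j => q ^ (j ^ 2) * c j) (L + 1)
        - q * baileySum q 0 (fun j => q ^ (j ^ 2) * c j) L := by
  have h0 : ∀ M, baileySum q 0 (fun j => q ^ (j ^ 2) * c j) M = ∑ᶠ j, c j * gaussTerm q M j := by
    intro M
    refine finsum_congr fun j => ?_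
    rw [gaussTerm, Nat.cast_zero, add_zero]
    ring
  have hfin : ∀ (d : ℤ → K) (M : ℕ), (Function.support fun j => d j * gaussTerm q M j).Finite :=
    fun d M => finite_support_of_Icc (-(M : ℤ)) M fun k hk => by
      rw [gaussTerm, qPochhammerRecip_mul_eq_zero q (by omega), mul_zero, mul_zero]
  have s1 := finsum_comp_equiv (Equiv.subRight (1 : ℤ))
    (f := fun j : ℤ => c (j + 1) * gaussTerm q (L + 1) j)
  have s2 := finsum_comp_equiv (Equiv.addRight (1 : ℤ))
    (f := fun j : ℤ => c (j - 1) * gaussTerm q (L + 1) j)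
  have f1 := (hfin (fun j => c (j + 1)) (L + 1)).preimage
    (Equiv.subRight (1 : ℤ)).injective.injOn
  have f2 := (hfin (fun j => c (j - 1)) (L + 1)).preimage
    (Equiv.addRight (1 : ℤ)).injective.injOn
  have f1' : (Function.support fun j : ℤ => c j * gaussTerm q (L + 1) (j - 1)).Finite :=
    f1.subset fun j hj => by simpa using hj
  have f2' : (Function.support fun j : ℤ => c j * gaussTerm q (L + 1) (j + 1)).Finite :=
    f2.subset fun j hj => by simpa using hj
  simp only [Equiv.subRight_apply, Equiv.coe_addRight, sub_add_cancel, add_sub_cancel_right]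
    at s1 s2
  have s3 : ∑ᶠ j : ℤ, c j * gaussTerm q (L + 1) (j - 1)
      + ∑ᶠ j : ℤ, c j * gaussTerm q (L + 1) (j + 1) = -∑ᶠ j, c j * gaussTerm q (L + 1) j := by
    rw [s1, s2, ← finsum_add_distrib (hfin (fun j => c (j + 1)) _) (hfin (fun j => c (j - 1)) _),
      ← finsum_neg_distrib]
    refine finsum_congr fun j => ?_
    linear_combination gaussTerm q (L + 1) j * hc j
  have fm : ∀ (a : K) (M : ℕ), (Function.support fun j => a * (c j * gaussTerm q M j)).Finite :=
    fun a M => (hfin c M).subset fun j hj => right_ne_zero_of_mul hj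
  have main : (1 - q ^ (2 * L + 3)) * (1 - q ^ (2 * L + 4)) * ∑ᶠ j, c j * gaussTerm q (L + 2) j
      + q * ∑ᶠ j, c j * gaussTerm q L j = (1 + q) * ∑ᶠ j, c j * gaussTerm q (L + 1) j
      + q ^ (2 * L + 3) * (∑ᶠ j : ℤ, c j * gaussTerm q (L + 1) (j - 1)
      + ∑ᶠ j : ℤ, c j * gaussTerm q (L + 1) (j + 1)) := by
    rw [← finsum_add_distrib f1' f2', mul_finsum, mul_finsum, mul_finsum, mul_finsum,
      ← finsum_add_distrib (fm _ _) (fm _ _), ← finsum_add_distrib (fm _ _)]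
    · refine finsum_congr fun j => ?_
      linear_combination c j * gaussTerm_recurrence hq hq0 L j
    · refine (f1'.union f2').subset fun j hj => ?_
      by_contra h
      simp only [Set.mem_union, Function.mem_support, not_or, not_not] at h
      exact hj (by beta_reduce; rw [h.1, h.2, add_zero, mul_zero])
  rw [h0, h0, h0]
  linear_combination main + q ^ (2 * L + 3) * s3

end Recurrence

/-! ### Contiguous relations for the Capparelli double sum -/

section CapparelliSum

variable {K : Type*} [Field K] {q : K}

/-- The summand of the Capparelli double sum, with linear weights `a`, `b` in the exponent. -/
noncomputable def capTerm (q : K) (a b : ℕ) (L : ℤ) (m k : ℕ) : K :=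
  q ^ (2 * m ^ 2 + 6 * m * k + 6 * k ^ 2 + a * m + b * k) * (1 / qPochhammer q q m)
    * (1 / qPochhammer (q ^ 3) (q ^ 3) k) * qPochhammerRecip q (L - 3 * k - 2 * m)

/-- The Capparelli double sum. -/
noncomputable def capSum (q : K) (a b L : ℕ) : K :=
  ∑ m ∈ Finset.range (L + 1), ∑ k ∈ Finset.range (L + 1), capTerm q a b L m k

theorem capTerm_eq_zero (q : K) (a b : ℕ) {L : ℤ} {m k : ℕ} (h : L < 3 * k + 2 * m) :
    capTerm q a b L m k = 0 := by
  rw [capTerm, qPochhammerRecip_of_neg q (by omega), mul_zero]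

theorem capSum_eq (q : K) (a b L : ℕ) {M N : ℕ} (hM : L + 1 ≤ M) (hN : L + 1 ≤ N) :
    capSum q a b L = ∑ m ∈ Finset.range M, ∑ k ∈ Finset.range N, capTerm q a b L m k := by
  rw [capSum]
  have h1 : ∀ m, ∑ k ∈ Finset.range (L + 1), capTerm q a b L m k
      = ∑ k ∈ Finset.range N, capTerm q a b L m k := fun m =>
    Finset.sum_subset (Finset.range_mono hN) fun k _ hk => capTerm_eq_zero q a b (by
      rw [Finset.mem_range] at hk; omega)
  simp only [h1]
  exact Finset.sum_subset (Finset.range_mono hM) fun m _ hm =>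
    Finset.sum_eq_zero fun k _ => capTerm_eq_zero q a b (by rw [Finset.mem_range] at hm; omega)

/-- Shifting $m$ in the quadratic form produces the linear terms $4m+6k$, which the weights absorb;
this is why general $a,b$ are carried. -/
theorem capTerm_succ_left (hq : ∀ k : ℕ, 1 ≤ k → q ^ k ≠ 1) (a b : ℕ) (L : ℤ) (m k : ℕ) :
    (1 - q ^ (m + 1)) * capTerm q a b L (m + 1) k
      = q ^ (2 + a) * capTerm q (a + 4) (b + 6) (L - 2) m k := by
  have h1 := qPochhammer_self_ne_zero hq m
  have h2 := one_sub_pow_ne_zero hq (n := m + 1) (by omega)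
  rw [capTerm, capTerm, qPochhammer_self_succ,
    show L - 3 * (k : ℤ) - 2 * ((m + 1 : ℕ) : ℤ) = L - 2 - 3 * k - 2 * m by push_cast; ring,
    show 2 * (m + 1) ^ 2 + 6 * (m + 1) * k + 6 * k ^ 2 + a * (m + 1) + b * k
      = 2 + a + (2 * m ^ 2 + 6 * m * k + 6 * k ^ 2 + (a + 4) * m + (b + 6) * k) by ring,
    pow_add q (2 + a)]
  field_simp

theorem capTerm_succ_right (hq : ∀ k : ℕ, 1 ≤ k → q ^ k ≠ 1) (a b : ℕ) (L : ℤ) (m k : ℕ) :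
    (1 - q ^ (3 * (k + 1))) * capTerm q a b L m (k + 1)
      = q ^ (6 + b) * capTerm q (a + 6) (b + 12) (L - 3) m k := by
  have h1 := qPochhammer_cube_ne_zero hq k
  have h2 := one_sub_pow_ne_zero hq (n := 3 * (k + 1)) (by omega)
  rw [capTerm, capTerm, qPochhammer_self_succ, ← pow_mul,
    show L - 3 * ((k + 1 : ℕ) : ℤ) - 2 * m = L - 3 - 3 * k - 2 * m by push_cast; ring,
    show 2 * m ^ 2 + 6 * m * (k + 1) + 6 * (k + 1) ^ 2 + a * m + b * (k + 1)
      = 6 + b + (2 * m ^ 2 + 6 * m * k + 6 * k ^ 2 + (a + 6) * m + (b + 12) * k) by ring,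
    pow_add q (6 + b)]
  field_simp

theorem capTerm_weight_left (q : K) (a b : ℕ) (L : ℤ) (m k : ℕ) :
    capTerm q (a + 1) b L m k = q ^ m * capTerm q a b L m k := by
  rw [capTerm, capTerm, show 2 * m ^ 2 + 6 * m * k + 6 * k ^ 2 + (a + 1) * m + b * k
    = m + (2 * m ^ 2 + 6 * m * k + 6 * k ^ 2 + a * m + b * k) by ring, pow_add q m]
  ring

theorem capTerm_weight_right (q : K) (a b : ℕ) (L : ℤ) (m k : ℕ) :
    capTerm q a (b + 3) L m k = q ^ (3 * k) * capTerm q a b L m k := by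
  rw [capTerm, capTerm, show 2 * m ^ 2 + 6 * m * k + 6 * k ^ 2 + a * m + (b + 3) * k
    = 3 * k + (2 * m ^ 2 + 6 * m * k + 6 * k ^ 2 + a * m + b * k) by ring, pow_add q (3 * k)]
  ring

/-- With $n=L-3k-2m\ge0$, the difference of reciprocals is $q^n/(q;q)_n$, and the extra weight
$q^{2m+3k}$ completes $q^n$ to $q^L$. -/
theorem capTerm_sub (hq : ∀ k : ℕ, 1 ≤ k → q ^ k ≠ 1) (a b L m k : ℕ) :
    capTerm q (a + 2) (b + 3) L m k - capTerm q (a + 2) (b + 3) ((L : ℤ) - 1) m k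
      = q ^ L * capTerm q a b L m k := by
  rw [capTerm_weight_right, capTerm_weight_right, capTerm_weight_left, capTerm_weight_left,
    capTerm_weight_left, capTerm_weight_left]
  rcases lt_or_ge L (3 * k + 2 * m) with h | h
  · rw [capTerm_eq_zero q a b (by omega), capTerm_eq_zero q a b (by omega)]
    ring
  · obtain ⟨n, rfl⟩ := Nat.exists_eq_add_of_le h
    rw [capTerm, capTerm,
      show ((3 * k + 2 * m + n : ℕ) : ℤ) - 1 - 3 * k - 2 * m = n - 1 by push_cast; ring,
      show ((3 * k + 2 * m + n : ℕ) : ℤ) - 3 * k - 2 * m = n by push_cast; ring,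
      qPochhammerRecip_sub_one hq, zpow_natCast]
    ring

theorem capSum_sub_left (hq : ∀ k : ℕ, 1 ≤ k → q ^ k ≠ 1) (a b L : ℕ) {M N : ℕ} (hM : L ≤ M)
    (hN : L + 1 ≤ N) :
    capSum q a b L - capSum q (a + 1) b L = q ^ (2 + a) *
      ∑ m ∈ Finset.range M, ∑ k ∈ Finset.range N, capTerm q (a + 4) (b + 6) ((L : ℤ) - 2) m k := by
  rw [capSum_eq q a b L (M := M + 1) (by omega) hN,
    capSum_eq q (a + 1) b L (M := M + 1) (by omega) hN]
  simp only [← Finset.sum_sub_distrib, capTerm_weight_left q a b, Finset.mul_sum]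
  -- The factor $1-q^m$ kills the $m=0$ terms; the rest are shifted by one.
  rw [Finset.sum_range_succ', Finset.sum_eq_zero (f := fun k =>
    capTerm q a b L 0 k - q ^ 0 * capTerm q a b L 0 k) (fun k _ => by simp), add_zero]
  refine Finset.sum_congr rfl fun m _ => Finset.sum_congr rfl fun k _ => ?_
  rw [← capTerm_succ_left hq]
  ring

theorem capSum_sub_right (hq : ∀ k : ℕ, 1 ≤ k → q ^ k ≠ 1) (a b L : ℕ) {M N : ℕ}
    (hM : L + 1 ≤ M) (hN : L ≤ N) :
    capSum q a b L - capSum q a (b + 3) L = q ^ (6 + b) *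
      ∑ m ∈ Finset.range M, ∑ k ∈ Finset.range N, capTerm q (a + 6) (b + 12) ((L : ℤ) - 3) m k := by
  rw [capSum_eq q a b L (N := N + 1) hM (by omega),
    capSum_eq q a (b + 3) L (N := N + 1) hM (by omega)]
  simp only [← Finset.sum_sub_distrib, capTerm_weight_right q a b, Finset.mul_sum]
  refine Finset.sum_congr rfl fun m _ => ?_
  rw [Finset.sum_range_succ', mul_zero, pow_zero, one_mul, sub_self, add_zero]
  refine Finset.sum_congr rfl fun k _ => ?_
  rw [← capTerm_succ_right hq]
  ring

theorem capSum_diff (hq : ∀ k : ℕ, 1 ≤ k → q ^ k ≠ 1) (a b L : ℕ) :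
    capSum q (a + 2) (b + 3) (L + 1) - capSum q (a + 2) (b + 3) L
      = q ^ (L + 1) * capSum q a b (L + 1) := by
  rw [capSum_eq q _ _ L (M := L + 1 + 1) (N := L + 1 + 1) (by omega) (by omega),
    capSum, capSum]
  simp only [← Finset.sum_sub_distrib, Finset.mul_sum, ← capTerm_sub hq]
  push_cast
  simp only [add_sub_cancel_right]

/-- The generating function of the Capparelli double sums. -/
noncomputable def capSeries (q : K) (a b : ℕ) : PowerSeries K :=
  PowerSeries.mk fun L => capSum q a b L

open PowerSeries

theorem capSeries_sub_left (hq : ∀ k : ℕ, 1 ≤ k → q ^ k ≠ 1) (a b : ℕ) :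
    capSeries q a b - capSeries q (a + 1) b
      = C (q ^ (2 + a)) * (X ^ 2 * capSeries q (a + 4) (b + 6)) := by
  ext n
  rw [map_sub, coeff_C_mul, coeff_X_pow_mul']
  simp only [capSeries, coeff_mk]
  rw [capSum_sub_left hq a b n (M := n) (N := n + 1) le_rfl le_rfl]
  split_ifs with h
  · rw [capSum_eq q _ _ (n - 2) (M := n) (N := n + 1) (by omega) (by omega), Nat.cast_sub h]
    rfl
  · rw [Finset.sum_eq_zero fun m _ => Finset.sum_eq_zero fun k _ =>
      capTerm_eq_zero q _ _ (by omega)]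

theorem capSeries_sub_right (hq : ∀ k : ℕ, 1 ≤ k → q ^ k ≠ 1) (a b : ℕ) :
    capSeries q a b - capSeries q a (b + 3)
      = C (q ^ (6 + b)) * (X ^ 3 * capSeries q (a + 6) (b + 12)) := by
  ext n
  rw [map_sub, coeff_C_mul, coeff_X_pow_mul']
  simp only [capSeries, coeff_mk]
  rw [capSum_sub_right hq a b n (M := n + 1) (N := n) le_rfl le_rfl]
  split_ifs with h
  · rw [capSum_eq q _ _ (n - 3) (M := n + 1) (N := n) (by omega) (by omega), Nat.cast_sub h]
    rfl
  · rw [Finset.sum_eq_zero fun m _ => Finset.sum_eq_zero fun k _ =>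
      capTerm_eq_zero q _ _ (by omega)]

theorem capSum_zero_right (q : K) (a b : ℕ) : capSum q a b 0 = 1 := by
  simp [capSum, capTerm, qPochhammerRecip_zero, qPochhammer_zero]

theorem rescale_capSeries (hq : ∀ k : ℕ, 1 ≤ k → q ^ k ≠ 1) (a b : ℕ) :
    rescale q (capSeries q a b) = (1 - X) * capSeries q (a + 2) (b + 3) := by
  ext n
  rw [coeff_rescale, sub_mul, one_mul, map_sub]
  cases n with
  | zero => simp [capSeries, capSum_zero_right]
  | succ n =>
    rw [coeff_succ_X_mul]
    simp only [capSeries, coeff_mk]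
    exact (capSum_diff hq a b n).symm

end CapparelliSum

/-! ### Recurrence for the double sum, and the seed identity -/

section CapparelliRecurrence

variable {K : Type*} [Field K] {q : K}

open PowerSeries

/-- Contiguous relations telescope along weights such as $(0,0)\to(0,3)\to(1,3)\to(2,3)$; the
combination is chosen so that all weights but multiples of $(2,3)$ cancel. -/
theorem capSeries_functional_equation (hq : ∀ k : ℕ, 1 ≤ k → q ^ k ≠ 1) :
    capSeries q 0 0 - (1 + C q * X) * capSeries q 2 3 + C q * X * (1 - C q * X) * capSeries q 4 6
      - C q ^ 3 * X ^ 2 * (1 - C q ^ 2 * X) * capSeries q 6 9 = 0 := by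
  have A := capSeries_sub_left hq
  have B := capSeries_sub_right hq
  simp only [map_pow] at A B
  linear_combination B 0 0 + A 0 3 + A 1 3 - C q * X * (B 2 3 + A 2 6 + A 3 6)
    - C q ^ 2 * X ^ 2 * B 4 6 + C q ^ 3 * X ^ 2 * A 5 9 + C q ^ 5 * X ^ 3 * B 6 9
    + C q ^ 6 * X ^ 3 * A 6 12 - C q ^ 10 * X ^ 4 * A 8 15

theorem capSum_recurrence (hq : ∀ k : ℕ, 1 ≤ k → q ^ k ≠ 1) (n : ℕ) :
    (1 - q ^ (n + 2)) * capSum q 0 0 (n + 2)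
      = (1 + q - q ^ (2 * n + 3)) * capSum q 0 0 (n + 1)
        - q * (1 - q ^ (2 * n + 1)) * (1 + q ^ (n + 1)) * capSum q 0 0 n := by
  have hC : rescale q (C q) = C q := by
    ext n
    rw [coeff_rescale, coeff_C]
    split_ifs with h <;> simp [h]
  have r1 := rescale_capSeries hq 0 0
  have r2 := congrArg (rescale q) r1
  have r3 := congrArg (rescale q) r2
  -- Weights $(2,3),(4,6),(6,9)$ are iterated rescalings $X\mapsto qX$ of weight $(0,0)$, up to
  -- factors $1-q^iX$. Multiplying the functional equation by $(1-X)(1-qX)$ therefore gives a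
  -- $q$-difference equation for one series.
  simp only [map_mul, map_sub, map_one, rescale_X, rescale_capSeries hq, hC] at r1 r2 r3
  have key : capSeries q 0 0 - rescale q (capSeries q 0 0)
      = (1 + C q) * (X * capSeries q 0 0)
        - C q * (X * rescale q (rescale q (capSeries q 0 0)))
        - C q * (X ^ 2 * (capSeries q 0 0 + C q * rescale q (capSeries q 0 0)
          - C q * rescale q (rescale q (capSeries q 0 0))
          - C q * (C q * rescale q (rescale q (rescale q (capSeries q 0 0)))))) := by
    simp only [map_mul, map_sub, map_one, rescale_X, rescale_capSeries hq, hC]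
    linear_combination (1 - X) * (1 - C q * X) * capSeries_functional_equation hq
  have h := congrArg (coeff (n + 2)) key
  simp only [map_sub, map_add, add_mul, one_mul, coeff_C_mul, coeff_rescale, coeff_X_pow_mul,
    coeff_succ_X_mul, capSeries, coeff_mk] at h
  linear_combination h

/-- The character `j ↦ ((j+1)/3)`, with values in a field. -/
def jacobiChar (K : Type*) [Field K] (j : ℤ) : K := (jacobiSym (j + 1) 3 : K)

theorem jacobiSym_three_mod (a : ℤ) : jacobiSym a 3 = jacobiSym (a % 3) 3 :=
  jacobiSym.mod_left a 3

theorem jacobiChar_eq (K : Type*) [Field K] (j : ℤ) : jacobiChar K j =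
    if j % 3 = 0 then 1 else if j % 3 = 1 then -1 else 0 := by
  have h0 : jacobiSym 0 3 = 0 := by norm_num
  have h1 : jacobiSym 1 3 = 1 := by norm_num
  have h2 : jacobiSym 2 3 = -1 := by norm_num
  rw [jacobiChar, jacobiSym_three_mod]
  have h : j % 3 = 0 ∨ j % 3 = 1 ∨ j % 3 = 2 := by omega
  rcases h with h | h | h
  · rw [show (j + 1) % 3 = 1 by omega, h1, if_pos h]; simp
  · rw [show (j + 1) % 3 = 2 by omega, h2, if_neg (by omega), if_pos h]; simp
  · rw [show (j + 1) % 3 = 0 by omega, h0, if_neg (by omega), if_neg (by omega)]; simp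

theorem jacobiChar_antisymm (K : Type*) [Field K] (j : ℤ) :
    jacobiChar K (1 - j) = -jacobiChar K j := by
  rw [jacobiChar_eq, jacobiChar_eq]
  split_ifs <;> first | omega | simp

theorem jacobiChar_add_three (K : Type*) [Field K] (j : ℤ) :
    jacobiChar K (j - 1) + jacobiChar K j + jacobiChar K (j + 1) = 0 := by
  rw [jacobiChar_eq, jacobiChar_eq, jacobiChar_eq]
  split_ifs <;> first | omega | simp

theorem baileySum_zero_right (q : K) (c : ℤ → K) : baileySum q 0 c 0 = c 0 := by
  rw [baileySum, finsum_eq_single _ (0 : ℤ)]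
  · simp [qPochhammerRecip_zero]
  · intro j hj
    rw [qPochhammerRecip_mul_eq_zero q (by push_cast; omega), mul_zero]

theorem baileySum_eq_sum (q : K) (c : ℤ → K) (L : ℕ) : baileySum q 0 c L =
    ∑ j ∈ Finset.Icc (-(L : ℤ)) L, c j * (qPochhammerRecip q (L - j) * qPochhammerRecip q (L + j)) := by
  rw [baileySum, finsum_eq_sum_of_support_subset (s := Finset.Icc (-L : ℤ) L)]
  · simp
  · intro j hj
    by_contra h
    rw [Finset.coe_Icc, Set.mem_Icc] at h
    exact hj (by beta_reduce; rw [qPochhammerRecip_mul_eq_zero q (by push_cast; omega), mul_zero])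

theorem qPochhammerRecip_one (q : K) : qPochhammerRecip q 1 = 1 / (1 - q) := by
  simp [qPochhammerRecip, qPochhammer]

theorem qPochhammerRecip_two (q : K) : qPochhammerRecip q 2 = 1 / ((1 - q) * (1 - q ^ 2)) := by
  simp [qPochhammerRecip, qPochhammer, Finset.prod_range_succ, sq]

/-- Both sides satisfy $U_{n+2}=(1+q-q^{2n+3})U_{n+1}-q(1-q^{2n+1})(1-q^{2n+2})U_n$ and agree at
$L=0,1$. -/
theorem capSum_eq_baileySum (hq : ∀ k : ℕ, 1 ≤ k → q ^ k ≠ 1) (hq0 : q ≠ 0) (L : ℕ) :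
    qPochhammer q q L * capSum q 0 0 L
      = qPochhammer q q (2 * L) * baileySum q 0 (fun j => q ^ (j ^ 2) * jacobiChar K j) L := by
  induction L using Nat.twoStepInduction with
  | zero => simp [capSum_zero_right, baileySum_zero_right, qPochhammer_zero, jacobiChar_eq]
  | one =>
    have h1 := one_sub_pow_ne_zero hq (n := 1) le_rfl
    have h2 := one_sub_pow_ne_zero hq (n := 2) (by omega)
    have h3 : capSum q 0 0 1 = 1 / (1 - q) := by
      simp [capSum, Finset.sum_range_succ, capTerm, qPochhammerRecip_one, qPochhammer_zero,
        qPochhammerRecip_of_neg]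
    have h4 : Finset.Icc (-((1 : ℕ) : ℤ)) ((1 : ℕ) : ℤ) = {-1, 0, 1} := by decide
    rw [h3, baileySum_eq_sum, h4]
    simp [jacobiChar_eq, qPochhammerRecip_zero, qPochhammerRecip_one]
    norm_num [qPochhammerRecip_two, qPochhammer, Finset.prod_range_succ]
    rw [pow_one] at h1
    field_simp
    ring
  | more n ih0 ih1 =>
    have c := capSum_recurrence hq n
    have b := baileySum_recurrence hq hq0 (jacobiChar_add_three K) n
    rw [show 2 * (n + 2) = 2 * n + 1 + 1 + 1 + 1 by ring]
    rw [show 2 * (n + 1) = 2 * n + 1 + 1 by ring] at ih1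
    simp only [qPochhammer_self_succ] at ih1 ⊢
    linear_combination qPochhammer q q n * (1 - q ^ (n + 1)) * c
      - qPochhammer q q (2 * n) * (1 - q ^ (2 * n + 1)) * (1 - q ^ (2 * n + 2)) * b
      + (1 + q - q ^ (2 * n + 3)) * ih1
      - q * (1 - q ^ (2 * n + 1)) * (1 - q ^ (2 * n + 2)) * ih0

end CapparelliRecurrence

/-! ### Peeling the tuple: iterating the Bailey chain -/

section Tuples

theorem entry_cons_one {f : ℕ} (a : ℕ) (v : Fin f → ℕ) :
    entry (Fin.cons a v : Fin (f + 1) → ℕ) 1 = a := by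
  rw [entry, dif_pos ⟨le_rfl, by omega⟩]
  rfl

theorem entry_cons_succ {f : ℕ} (a : ℕ) (v : Fin f → ℕ) {i : ℕ} (hi : 1 ≤ i) :
    entry (Fin.cons a v : Fin (f + 1) → ℕ) (i + 1) = entry v i := by
  obtain ⟨i, rfl⟩ := Nat.exists_eq_add_of_le' hi
  by_cases h : i + 1 ≤ f
  · rw [entry, entry, dif_pos ⟨by omega, by omega⟩, dif_pos ⟨by omega, h⟩]
    rfl
  · rw [entry, entry, dif_neg (by omega), dif_neg (by omega)]

theorem prod_Icc_succ_succ {M : Type*} [CommMonoid M] (a b : ℕ) (g : ℕ → M) :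
    ∏ i ∈ Finset.Icc (a + 1) (b + 1), g i = ∏ i ∈ Finset.Icc a b, g (i + 1) := by
  rw [← Finset.map_add_right_Icc, Finset.prod_map]
  rfl

theorem sum_Icc_succ_succ {M : Type*} [AddCommMonoid M] (a b : ℕ) (g : ℕ → M) :
    ∑ i ∈ Finset.Icc (a + 1) (b + 1), g i = ∑ i ∈ Finset.Icc a b, g (i + 1) := by
  rw [← Finset.map_add_right_Icc, Finset.sum_map]
  rfl

theorem sum_Icc_one_succ {M : Type*} [AddCommMonoid M] (b : ℕ) (g : ℕ → M) :
    ∑ i ∈ Finset.Icc 1 (b + 1), g i = g 1 + ∑ i ∈ Finset.Icc 1 b, g (i + 1) := by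
  rw [← Finset.add_sum_Ioc_eq_sum_Icc (by omega), ← sum_Icc_succ_succ]
  rfl

theorem prod_Icc_one_succ {M : Type*} [CommMonoid M] (b : ℕ) (g : ℕ → M) :
    ∏ i ∈ Finset.Icc 1 (b + 1), g i = g 1 * ∏ i ∈ Finset.Icc 1 b, g (i + 1) := by
  rw [← Finset.mul_prod_Ioc_eq_prod_Icc (by omega), ← prod_Icc_succ_succ]
  rfl

theorem tailSum_cons_succ {f : ℕ} (a : ℕ) (v : Fin f → ℕ) {i : ℕ} (hi : 1 ≤ i) :
    tailSum (Fin.cons a v : Fin (f + 1) → ℕ) (i + 1) = tailSum v i := by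
  rw [tailSum, tailSum, sum_Icc_succ_succ]
  exact Finset.sum_congr rfl fun k hk => entry_cons_succ a v (by rw [Finset.mem_Icc] at hk; omega)

theorem tailSum_cons_one {f : ℕ} (a : ℕ) (v : Fin f → ℕ) :
    tailSum (Fin.cons a v : Fin (f + 1) → ℕ) 1 = a + tailSum v 1 := by
  rw [tailSum, tailSum, sum_Icc_one_succ, entry_cons_one]
  exact congrArg _ (Finset.sum_congr rfl fun k hk =>
    entry_cons_succ a v (by rw [Finset.mem_Icc] at hk; omega))

theorem le_tailSum_one {f : ℕ} (v : Fin f → ℕ) (i : Fin f) : v i ≤ tailSum v 1 := by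
  have h : v i = entry v (i + 1) := by
    rw [entry, dif_pos ⟨by omega, by omega⟩]
    rfl
  rw [h, tailSum]
  exact Finset.single_le_sum (f := entry v) (fun _ _ => Nat.zero_le _)
    (Finset.mem_Icc.2 ⟨by omega, by omega⟩)

theorem sum_sq_tailSum_cons {f : ℕ} (a : ℕ) (v : Fin f → ℕ) :
    ∑ i ∈ Finset.Icc 1 (f + 1), tailSum (Fin.cons a v : Fin (f + 1) → ℕ) i ^ 2
      = (a + tailSum v 1) ^ 2 + ∑ i ∈ Finset.Icc 1 f, tailSum v i ^ 2 := by
  rw [sum_Icc_one_succ, tailSum_cons_one]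
  exact congrArg _ (Finset.sum_congr rfl fun k hk => by
    rw [tailSum_cons_succ a v (by rw [Finset.mem_Icc] at hk; omega)])

theorem sum_tailSum_cons {f : ℕ} (a : ℕ) (v : Fin f → ℕ) {s : ℕ} (hsf : s ≤ f + 1) :
    ∑ i ∈ Finset.Icc (f + 1 - s + 1) (f + 1), tailSum (Fin.cons a v : Fin (f + 1) → ℕ) i
      = (if s = f + 1 then 1 else 0) * (a + tailSum v 1)
        + ∑ i ∈ Finset.Icc (f - min s f + 1) f, tailSum v i := by
  split_ifs with h
  · rw [h, Nat.sub_self, zero_add, sum_Icc_one_succ, tailSum_cons_one, one_mul,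
      min_eq_right (by omega), Nat.sub_self, zero_add]
    exact congrArg _ (Finset.sum_congr rfl fun k hk =>
      tailSum_cons_succ a v (by rw [Finset.mem_Icc] at hk; omega))
  · rw [min_eq_left (by omega), zero_mul, zero_add, sum_Icc_succ_succ,
      show f + 1 - s = f - s + 1 by omega]
    exact Finset.sum_congr rfl fun k hk =>
      tailSum_cons_succ a v (by rw [Finset.mem_Icc] at hk; omega)

theorem sum_piFinset_cons {M : Type*} [AddCommMonoid M] (f N : ℕ) (g : (Fin (f + 1) → ℕ) → M) :
    ∑ v ∈ Fintype.piFinset (fun _ : Fin (f + 1) => Finset.range N), g v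
      = ∑ v ∈ Fintype.piFinset (fun _ : Fin f => Finset.range N), ∑ a ∈ Finset.range N,
          g (Fin.cons a v) := by
  rw [Finset.sum_comm, ← Finset.sum_product']
  refine (Finset.sum_nbij' (fun p : ℕ × (Fin f → ℕ) => (Fin.cons p.1 p.2 : Fin (f + 1) → ℕ))
    (fun v => (v 0, Fin.tail v)) ?_ ?_ ?_ ?_ ?_).symm
  · rintro ⟨a, v⟩ h
    rw [Finset.mem_product, Fintype.mem_piFinset] at h
    exact Fintype.mem_piFinset.2 (Fin.cases h.1 h.2)
  · intro v h
    rw [Fintype.mem_piFinset] at h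
    exact Finset.mem_product.2 ⟨h 0, Fintype.mem_piFinset.2 fun i => h i.succ⟩
  · rintro ⟨a, v⟩ _
    simp
  · intro v _
    simp
  · intro p _
    rfl

variable {K : Type*} [Field K] {q : K}

/-- The part of the multisum that depends on `v = (n_1, …, n_f)`, with seed `β`. -/
noncomputable def tupleTerm (q : K) (β : ℕ → K) (L f s : ℕ) (v : Fin f → ℕ) : K :=
  q ^ (∑ i ∈ Finset.Icc 1 f, tailSum v i ^ 2 + ∑ i ∈ Finset.Icc (f - s + 1) f, tailSum v i)
    * qPochhammerRecip q ((L : ℤ) - tailSum v 1)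
    * (1 / ∏ i ∈ Finset.Icc 1 (f - 1), qPochhammer q q (entry v i)) * β (entry v f)

theorem sum_range_add_eq (φ : ℕ → K) {L N t : ℕ} (hN : L + 1 ≤ N) (hL : ∀ r, L < r → φ r = 0)
    (ht : ∀ r, r < t → φ r = 0) :
    ∑ a ∈ Finset.range N, φ (a + t) = ∑ r ∈ Finset.range (L + 1), φ r := by
  have h := Finset.sum_range_add φ t N
  rw [Finset.sum_eq_zero fun r hr => ht r (Finset.mem_range.1 hr), zero_add] at h
  rw [Finset.sum_congr rfl fun a _ => by rw [add_comm a t], ← h]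
  exact (Finset.sum_subset (Finset.range_mono (by omega)) fun r _ hr =>
    hL r (by rw [Finset.mem_range] at hr; omega)).symm

/-- Substitute $r=N_1$ for $n_1$: the factor $1/(q;q)_{n_1}=1/(q;q)_{r-N_2}$ becomes the boundary
factor of the shorter tuple, with $r$ in place of $L$. The linear term in $N_1$ is present only for
$s=f+1$. -/
theorem sum_tupleTerm_succ (q : K) (β : ℕ → K) {L N f s : ℕ} (hN : L + 1 ≤ N) (hf : 1 ≤ f)
    (hsf : s ≤ f + 1) :
    ∑ v ∈ Fintype.piFinset (fun _ : Fin (f + 1) => Finset.range N), tupleTerm q β L (f + 1) s v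
      = ∑ r ∈ Finset.range (L + 1), q ^ (r ^ 2 + (if s = f + 1 then 1 else 0) * r)
          * qPochhammerRecip q ((L : ℤ) - r)
          * ∑ v ∈ Fintype.piFinset (fun _ : Fin f => Finset.range N),
              tupleTerm q β r f (min s f) v := by
  simp only [Finset.mul_sum]
  rw [sum_piFinset_cons, Finset.sum_comm (s := Finset.range (L + 1))]
  refine Finset.sum_congr rfl fun v _ => ?_
  rw [← sum_range_add_eq (N := N) (t := tailSum v 1) _ hN]
  · refine Finset.sum_congr rfl fun a _ => ?_
    obtain ⟨g, rfl⟩ := Nat.exists_eq_add_of_le' hf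
    rw [tupleTerm, tupleTerm, sum_sq_tailSum_cons, sum_tailSum_cons a v hsf, tailSum_cons_one,
      entry_cons_succ a v (by omega), add_tsub_cancel_right, add_tsub_cancel_right,
      prod_Icc_one_succ, entry_cons_one, Finset.prod_congr rfl fun i hi =>
        congrArg (qPochhammer q q) (entry_cons_succ a v (i := i)
          (by rw [Finset.mem_Icc] at hi; omega)),
      show ((a + tailSum v 1 : ℕ) : ℤ) - tailSum v 1 = a by push_cast; ring,
      qPochhammerRecip_natCast, ← one_div_mul_one_div]
    simp only [pow_add]
    ring
  · intro r hr
    rw [qPochhammerRecip_of_neg q (k := (L : ℤ) - r) (by omega)]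
    ring
  · intro r hr
    rw [tupleTerm, qPochhammerRecip_of_neg q (k := (r : ℤ) - tailSum v 1) (by omega)]
    ring

theorem sum_tupleTerm_one (q : K) (β : ℕ → K) {L N : ℕ} (hN : L + 1 ≤ N) :
    ∑ v ∈ Fintype.piFinset (fun _ : Fin 1 => Finset.range N), tupleTerm q β L 1 1 v
      = ∑ r ∈ Finset.range (L + 1), q ^ (r ^ 2 + r) * qPochhammerRecip q ((L : ℤ) - r) * β r := by
  rw [sum_piFinset_cons]
  have h := sum_range_add_eq (N := N) (t := 0)
    (fun r => q ^ (r ^ 2 + r) * qPochhammerRecip q ((L : ℤ) - r) * β r) hN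
    (fun r hr => by rw [qPochhammerRecip_of_neg q (k := (L : ℤ) - r) (by omega)]; ring)
    (fun r hr => by omega)
  rw [← h, Fintype.piFinset_of_isEmpty, Finset.univ_unique, Finset.sum_singleton]
  refine Finset.sum_congr rfl fun a _ => ?_
  simp [tupleTerm, tailSum, entry_cons_one]

theorem sum_tupleTerm_eq_baileySum (hq : ∀ k : ℕ, 1 ≤ k → q ^ k ≠ 1) (hq0 : q ≠ 0) {β : ℕ → K}
    {N : ℕ} (hβ : ∀ r < N, β r = baileySum q 0 (fun j => q ^ (j ^ 2) * jacobiChar K j) r)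
    {f : ℕ} (hf : 1 ≤ f) {L s : ℕ} (hL : L < N) (hs : 1 ≤ s) (hsf : s ≤ f) :
    ∑ v ∈ Fintype.piFinset (fun _ : Fin f => Finset.range N), tupleTerm q β L f s v
      = baileySum q 0 (fun j => q ^ (((f : ℤ) + 1) * j ^ 2 - s * j) * jacobiChar K j) L := by
  -- After $t-1$ lattice steps the sequence is $q^{tj^2-(t-1)j}\chi(j)=q^{t(j^2-j)}\chi(j)\,q^j$, so
  -- this is the antisymmetry the next one needs.
  have hanti : ∀ t : ℤ, ∀ j : ℤ, q ^ (t * ((1 - j) ^ 2 - (1 - j))) * jacobiChar K (1 - j)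
      = -(q ^ (t * (j ^ 2 - j)) * jacobiChar K j) := fun t j => by
    rw [jacobiChar_antisymm, show (1 - j) ^ 2 - (1 - j) = j ^ 2 - j by ring, mul_neg]
  induction f, hf using Nat.le_induction generalizing L s with
  | base =>
    obtain rfl : s = 1 := by omega
    rw [sum_tupleTerm_one q β (by omega)]
    have step := bailey_lattice_step hq hq0
        (c := fun j => q ^ ((1 : ℤ) * (j ^ 2 - j)) * jacobiChar K j) (hanti _) L
    convert step using 1
    · refine Finset.sum_congr rfl fun r hr => ?_
      rw [hβ r (by rw [Finset.mem_range] at hr; omega)]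
      congr 2
      funext j
      rw [mul_right_comm, ← zpow_add₀ hq0]
      congr 2
      ring
    · congr 1
      funext j
      rw [← mul_assoc, ← zpow_add₀ hq0, mul_right_comm, ← zpow_add₀ hq0]
      congr 2
      push_cast
      ring
  | succ f hf ih =>
    rw [sum_tupleTerm_succ q β (by omega) hf hsf]
    have ih' : ∀ r ∈ Finset.range (L + 1), _ := fun r hr =>
      ih (L := r) (s := min s f) (by rw [Finset.mem_range] at hr; omega) (by omega) (by omega)
    split_ifs with h
    · subst h
      have step := bailey_lattice_step hq hq0
        (c := fun j => q ^ ((f + 1 : ℤ) * (j ^ 2 - j)) * jacobiChar K j) (hanti _) L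
      convert step using 1
      · refine Finset.sum_congr rfl fun r hr => ?_
        rw [ih' r hr, one_mul, min_eq_right (by omega)]
        congr 2
        funext j
        rw [mul_right_comm, ← zpow_add₀ hq0]
        congr 2
        ring
      · congr 1
        funext j
        rw [← mul_assoc, ← zpow_add₀ hq0, mul_right_comm, ← zpow_add₀ hq0]
        congr 2
        push_cast
        ring
    · have step := bailey_lemma hq hq0 L 0 (by omega)
        (fun j => q ^ (((f : ℤ) + 1) * j ^ 2 - s * j) * jacobiChar K j)
      convert step using 1
      · refine Finset.sum_congr rfl fun r hr => ?_
        rw [ih' r hr, min_eq_left (by omega)]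
      · congr 1
        funext j
        rw [← mul_assoc, ← zpow_add₀ hq0]
        congr 2
        push_cast
        ring

end Tuples

/-! ### Assembling the multisum, and the case q = 0 -/

section Assembly

variable {K : Type*} [Field K] {q : K}

theorem qBinomial_eq (q : K) (L : ℕ) (j : ℤ) : qBinomial q (2 * (L : ℤ)) (L - j)
    = qPochhammer q q (2 * L) * (qPochhammerRecip q (L - j) * qPochhammerRecip q (L + j)) := by
  rw [qBinomial, show 2 * (L : ℤ) - (L - j) = L + j by ring]
  split_ifs with h
  · rw [qPochhammerRecip, qPochhammerRecip, if_pos h.1, if_pos h.2, one_div_mul_one_div,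
      mul_one_div]
    rfl
  · rw [qPochhammerRecip_mul_eq_zero q (by omega), mul_zero]

theorem summand_eq (q : K) (L f s m n : ℕ) (v : Fin f → ℕ) :
    summand q L f s m n v = qPochhammer q q (2 * L) * tupleTerm q
      (fun r => qPochhammer q q r / qPochhammer q q (2 * r) * capTerm q 0 0 r m n) L f s v := by
  rw [summand, tupleTerm, capTerm, add_assoc (2 * m ^ 2 + 6 * m * n + 6 * n ^ 2), pow_add q
    (2 * m ^ 2 + 6 * m * n + 6 * n ^ 2)]
  simp only [zero_mul, add_zero, div_eq_mul_inv, mul_inv_rev]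
  ring

theorem tupleTerm_sum_sum (q : K) (c : ℕ → K) (g : ℕ → ℕ → ℕ → K) (S T : Finset ℕ) (L f s : ℕ)
    (v : Fin f → ℕ) :
    ∑ m ∈ S, ∑ n ∈ T, tupleTerm q (fun r => c r * g r m n) L f s v
      = tupleTerm q (fun r => c r * ∑ m ∈ S, ∑ n ∈ T, g r m n) L f s v := by
  simp only [tupleTerm, Finset.mul_sum]

/-- A finite box that carries all nonzero terms of the multisum. -/
def box (L f : ℕ) : Finset (ℕ × ℕ × (Fin f → ℕ)) :=
  Finset.range (L + 1) ×ˢ Finset.range (L + 1) ×ˢ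
    Fintype.piFinset (fun _ : Fin f => Finset.range (L + 1))

theorem support_summand_subset (q : K) (L f s : ℕ) :
    (Function.support fun p : ℕ × ℕ × (Fin f → ℕ) => summand q L f s p.1 p.2.1 p.2.2)
      ⊆ box L f := by
  rintro ⟨m, n, v⟩ h
  simp only [Function.mem_support, summand] at h
  have h1 : (tailSum v 1 : ℤ) ≤ L := by
    by_contra hc
    exact h (by rw [qPochhammerRecip_of_neg q (k := (L : ℤ) - tailSum v 1) (by omega)]; ring)
  have h2 : 0 ≤ (entry v f : ℤ) - 3 * n - 2 * m := by
    by_contra hc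
    exact h (by
      rw [qPochhammerRecip_of_neg q (k := (entry v f : ℤ) - 3 * n - 2 * m) (by omega)]; ring)
  have h3 : entry v f ≤ tailSum v 1 := by
    rw [entry]
    split_ifs with hf
    · exact le_tailSum_one v _
    · exact Nat.zero_le _
  simp only [box, Finset.coe_product, Set.mem_prod, Finset.mem_coe, Finset.mem_range,
    Fintype.mem_piFinset]
  refine ⟨by omega, by omega, fun i => ?_⟩
  have := le_tailSum_one v i
  omega

theorem finsum_summand_eq (hq : ∀ k : ℕ, 1 ≤ k → q ^ k ≠ 1) (hq0 : q ≠ 0) (L f s : ℕ)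
    (hs : 1 ≤ s) (hsf : s ≤ f) :
    ∑ᶠ p : ℕ × ℕ × (Fin f → ℕ), summand q L f s p.1 p.2.1 p.2.2
      = qPochhammer q q (2 * L)
        * baileySum q 0 (fun j => q ^ (((f : ℤ) + 1) * j ^ 2 - s * j) * jacobiChar K j) L := by
  rw [finsum_eq_sum_of_support_subset _ (support_summand_subset q L f s), box,
    Finset.sum_product, Finset.sum_congr rfl fun m _ => Finset.sum_product _ _ _,
    Finset.sum_congr rfl fun m _ => Finset.sum_comm, Finset.sum_comm]
  have hβ : ∀ r < L + 1, qPochhammer q q r / qPochhammer q q (2 * r)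
      * ∑ m ∈ Finset.range (L + 1), ∑ n ∈ Finset.range (L + 1), capTerm q 0 0 r m n
      = baileySum q 0 (fun j => q ^ (j ^ 2) * jacobiChar K j) r := fun r hr => by
    rw [← capSum_eq q 0 0 r (by omega) (by omega), div_mul_eq_mul_div,
      capSum_eq_baileySum hq hq0, mul_div_cancel_left₀ _ (qPochhammer_self_ne_zero hq _)]
  rw [← sum_tupleTerm_eq_baileySum hq hq0 hβ (hs.trans hsf) (Nat.lt_succ_self L) hs hsf,
    Finset.mul_sum]
  refine Finset.sum_congr rfl fun v _ => ?_
  simp only [summand_eq, ← Finset.mul_sum]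
  rw [tupleTerm_sum_sum]

theorem qPochhammer_zero_zero (n : ℕ) : qPochhammer (0 : K) 0 n = 1 := by
  simp [qPochhammer]

theorem finsum_summand_zero (L f s : ℕ) (hf : 1 ≤ f) :
    ∑ᶠ p : ℕ × ℕ × (Fin f → ℕ), summand (0 : K) L f s p.1 p.2.1 p.2.2 = 1 := by
  rw [finsum_eq_single _ (0, 0, 0)]
  · have h1 : ∀ i, entry (0 : Fin f → ℕ) i = 0 := fun i => by simp [entry]
    have h2 : ∀ i, tailSum (0 : Fin f → ℕ) i = 0 := fun i => by simp [tailSum, h1]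
    simp [summand, h1, h2, qPochhammer_zero_zero, qPochhammerRecip]
  · rintro ⟨m, n, v⟩ h
    rw [summand, zero_pow]
    · ring
    · intro hz
      refine h ?_
      simp only [add_eq_zero, Finset.sum_eq_zero_iff, pow_eq_zero_iff, mul_eq_zero, ne_eq,
        OfNat.ofNat_ne_zero, not_false_eq_true, false_or] at hz
      obtain ⟨⟨⟨⟨hm, -⟩, hn⟩, ht⟩, -⟩ := hz
      have ht1 := ht 1 (Finset.mem_Icc.2 ⟨le_rfl, hf⟩)
      have hv : v = 0 := funext fun i => by
        have := le_tailSum_one v i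
        simpa [ht1] using this
      rw [hm, hn, hv]

theorem sum_jacobi_zero (L f s : ℕ) (hsf : s ≤ f) :
    ∑ j ∈ Finset.Icc (-(L : ℤ)) (L : ℤ),
      (jacobiSym (j + 1) 3 : K) * 0 ^ (((f : ℤ) + 1) * j ^ 2 - (s : ℤ) * j)
        * qBinomial (0 : K) (2 * (L : ℤ)) ((L : ℤ) - j) = 1 := by
  rw [Finset.sum_eq_single 0]
  · rw [qBinomial_eq]
    simp [qPochhammer_zero_zero, qPochhammerRecip, jacobiSym.one_left]
  · intro j _ hj
    rw [zero_zpow, mul_zero, zero_mul]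
    -- The exponent is $j((f+1)j-s)$ and $0\le s<f+1$, so it vanishes only at $j=0$.
    intro h
    have h' : j * (((f : ℤ) + 1) * j - s) = 0 := by linear_combination h
    rcases mul_eq_zero.1 h' with h0 | h0
    · exact hj h0
    · rcases lt_or_gt_of_ne hj with hlt | hgt
      · nlinarith
      · nlinarith
  · intro h
    simp at h

end Assembly

end Capparelli

theorem mainTheorem3 {K : Type*} [Field K] (q : K) (hq : ∀ k : ℕ, 1 ≤ k → q ^ k ≠ 1)
    (L f s : ℕ) (hs : 1 ≤ s) (hsf : s ≤ f) :
    (Function.support (fun p : ℕ × ℕ × (Fin f → ℕ) =>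
      Capparelli.summand q L f s p.1 p.2.1 p.2.2)).Finite ∧
    ∑ᶠ p : ℕ × ℕ × (Fin f → ℕ), Capparelli.summand q L f s p.1 p.2.1 p.2.2 =
      ∑ j ∈ Finset.Icc (-(L : ℤ)) (L : ℤ),
        (jacobiSym (j + 1) 3 : K) * q ^ (((f : ℤ) + 1) * j ^ 2 - (s : ℤ) * j)
          * Capparelli.qBinomial q (2 * (L : ℤ)) ((L : ℤ) - j) := by
  refine ⟨(Finset.finite_toSet _).subset (Capparelli.support_summand_subset q L f s), ?_⟩
  -- The chain uses negative powers of $q$. At $q=0$ only the zero index on the left and $j=0$ on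
  -- the right contribute, each giving $1$.
  rcases eq_or_ne q 0 with rfl | hq0
  · rw [Capparelli.finsum_summand_zero L f s (hs.trans hsf), Capparelli.sum_jacobi_zero L f s hsf]
  · rw [Capparelli.finsum_summand_eq hq hq0 L f s hs hsf, Capparelli.baileySum_eq_sum,
      Finset.mul_sum]
    refine Finset.sum_congr rfl fun j _ => ?_
    rw [Capparelli.qBinomial_eq, Capparelli.jacobiChar]
    ring
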